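/- Let $\mathcal H$ be a real Hilbert space, $t_0\ge 0$ and $\lambda>0$. Let $\mu:[t_0,+\infty)\to(0,+\infty)$ be continuously differentiable and nondecreasing, let $\gamma:[t_0,+\infty)\to(0,+\infty)$ be continuous, and let $V:\mathcal H\to\mathcal H$ be $L$-Lipschitz continuous for some $L\ge 0$. Consider the Cauchy problem $$\ddot y(t)+\lambda\dot y(t)+\mu(t)\frac{d}{dt}V(y(t))+\gamma(t)V(y(t))=0,\qquad y(t_0)=y_0,\quad \dot y(t_0)=y_1. \qquad (\ast)$$ A function $y:[t_0,+\infty)\to\mathcal H$ is called a strong global solution of $(\ast)$ if (i) $y$ is differentiable on $[t_0,+\infty)$ (one-sidedly at $t_0$), and $y$ and $\dot y$ are locally absolutely continuous, that is, absolutely continuous on each interval $[t_0,t_1]$ with $t_1\ge t_0$; (ii) for almost every $t\in[t_0,+\infty)$ the derivatives $\ddot y(t)$ and $\frac{d}{dt}V(y(t))$ exist and the differential equation in $(\ast)$ holds at $t$; (iii) $y(t_0)=y_0$ and $\dot y(t_0)=y_1$. Then, for each $(y_0,y_1)\in\mathcal H\times\mathcal H$, the Cauchy problem $(\ast)$ has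 a unique strong global solution $y:[t_0,+\infty)\to\mathcal H$. -/

import Mathlib

open Set MeasureTheory
open scoped NNReal

/-- `f` is locally absolutely continuous on `[t₀, +∞)`, that is, absolutely continuous on each
compact interval `[t₀, t₁]`. Only the values of `f` on `[t₀, +∞)` matter. -/
def LocallyAbsolutelyContinuousFrom {H : Type*} [NormedAddCommGroup H]
    (f : ℝ → H) (t₀ : ℝ) : Prop :=
  ∀ t₁ : ℝ, t₀ ≤ t₁ → AbsolutelyContinuousOnInterval f t₀ t₁

/-- `y : [t₀, +∞) → H` is a strong global solution of the Cauchy problem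
`y'' + lam y' + μ(t) (d/dt) V(y(t)) + γ(t) V(y(t)) = 0`, `y(t₀) = y₀`, `y'(t₀) = y₁`.

A function on `[t₀, +∞)` is represented by a function on `ℝ` whose values outside `[t₀, +∞)` are
irrelevant: all derivatives are taken within `[t₀, +∞)` (one-sided at `t₀`). -/
structure IsStrongGlobalSolution {H : Type*} [NormedAddCommGroup H] [NormedSpace ℝ H]
    (t₀ lam : ℝ) (μ γ : ℝ → ℝ) (V : H → H) (y₀ y₁ : H) (y : ℝ → H) : Prop where
  /-- `y` is locally absolutely continuous. -/
  locAbsCont : LocallyAbsolutelyContinuousFrom y t₀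
  /-- The derivative of `y` exists on `[t₀, +∞)`. -/
  differentiableOn : DifferentiableOn ℝ y (Ici t₀)
  /-- The derivative of `y` is locally absolutely continuous. -/
  locAbsCont_deriv : LocallyAbsolutelyContinuousFrom (derivWithin y (Ici t₀)) t₀
  /-- For almost every `t ≥ t₀` the derivatives in the equation exist and the equation holds. -/
  equation : ∀ᵐ t ∂(volume.restrict (Ici t₀)),
    DifferentiableWithinAt ℝ (derivWithin y (Ici t₀)) (Ici t₀) t ∧
    DifferentiableWithinAt ℝ (fun s => V (y s)) (Ici t₀) t ∧
    derivWithin (derivWithin y (Ici t₀)) (Ici t₀) t + lam • derivWithin y (Ici t₀) t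
      + μ t • derivWithin (fun s => V (y s)) (Ici t₀) t + γ t • V (y t) = 0
  /-- Initial position. -/
  initial_pos : y t₀ = y₀
  /-- Initial velocity. -/
  initial_vel : derivWithin y (Ici t₀) t₀ = y₁

/-! With `w = y' + μ V(y)` the product rule absorbs the term `μ (V(y))'`, and the equation becomes
`y' = w - μ V(y)`, `w' = (μ' - γ) V(y) - lam y'`. This system no longer differentiates `V` and is
Lipschitz in `(y, w)`, with a constant continuous in time. It therefore has a global trajectory
(`exists_forall_hasDerivWithinAt_Ici_of_lipschitz`), unique by Grönwall.

Two points remain in passing between the system and strong solutions. For a strong solution, `w'` is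
known only almost everywhere, but `w` is absolutely continuous and the right-hand side is
continuous, so `w'` exists everywhere. For a trajectory, `V(y)` must be differentiable almost
everywhere: it is locally Lipschitz, and Lipschitz curves in a Hilbert space are
(`LipschitzWith.ae_differentiableAt_of_innerProductSpace`). -/

/-! ### Almost everywhere differentiability of Lipschitz curves in Hilbert spaces. -/

/-- A Lipschitz curve has increments controlled by the integral of
any bound of its normalized scalar derivatives. -/
theorem norm_sub_le_integral_of_deriv_inner_le {E : Type*} [NormedAddCommGroup E]
    [InnerProductSpace ℝ E] {C : ℝ≥0} {f : ℝ → E} (hf : LipschitzWith C f) {d : ℕ → E}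
    (hd : DenseRange d) {m : ℝ → ℝ} (hm : LocallyIntegrable m volume) (hm0 : ∀ t, 0 ≤ m t)
    (hdm : ∀ n t, deriv (fun s => inner ℝ (d n) (f s)) t ≤ ‖d n‖ * m t) {a b : ℝ} (hab : a ≤ b) :
    ‖f b - f a‖ ≤ ∫ t in a..b, m t := by
  have hint : IntervalIntegrable m volume a b := (hm.integrableOn_isCompact isCompact_uIcc).intervalIntegrable
  -- Integrating the scalar derivatives gives the bound at each `d n`, and density gives it at every
  -- `v`. The choice `v = f b - f a` then recovers the norm.
  have key : ∀ v : E, inner ℝ v (f b - f a) ≤ ‖v‖ * ∫ t in a..b, m t := by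
    intro v
    refine hd.induction_on (p := fun v => inner ℝ v (f b - f a) ≤ ‖v‖ * ∫ t in a..b, m t) v
      (isClosed_le (by fun_prop) (by fun_prop)) fun n => ?_
    have hL : LipschitzWith (‖innerSL ℝ (d n)‖₊ * C) (fun s => inner ℝ (d n) (f s)) :=
      (innerSL ℝ (d n)).lipschitz.comp hf
    have hAC := (hL.lipschitzOnWith (s := uIcc a b)).absolutelyContinuousOnInterval
    rw [inner_sub_right, ← hAC.integral_deriv_eq_sub, ← intervalIntegral.integral_const_mul]
    exact intervalIntegral.integral_mono_on hab hAC.intervalIntegrable_deriv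
      (hint.const_mul _) fun t _ => hdm n t
  have h := key (f b - f a)
  rw [real_inner_self_eq_norm_mul_norm] at h
  rcases (norm_nonneg (f b - f a)).eq_or_lt with h0 | h0
  · rw [← h0]
    exact intervalIntegral.integral_nonneg hab fun t _ => hm0 t
  · exact le_of_mul_le_mul_left h h0

open Filter Topology in
/-- A Lipschitz curve whose norm increments are controlled by a function `M` with derivative `m` at
`t`, where `m` is approximated by scalar derivatives of the curve, is differentiable at `t`. -/
theorem differentiableAt_of_norm_sub_le {E : Type*} [NormedAddCommGroup E]
    [InnerProductSpace ℝ E] [CompleteSpace E] {f : ℝ → E} {M : ℝ → ℝ} {t m : ℝ}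
    (hfM : ∀ a b, a ≤ b → ‖f b - f a‖ ≤ M b - M a) (hM : HasDerivAt M m t)
    (happ : ∀ ε > 0, ∃ u : E, ‖u‖ ≤ 1 ∧ ∃ l, HasDerivAt (fun s => inner ℝ u (f s)) l t ∧
      m - ε < l) :
    DifferentiableAt ℝ f t := by
  have hslope : ∀ s, ‖slope f t s‖ ≤ slope M t s := by
    intro s
    rw [slope_def_module, slope_def_field, norm_smul, norm_inv, Real.norm_eq_abs, div_eq_inv_mul]
    rcases le_total t s with h | h
    · rw [abs_of_nonneg (sub_nonneg.2 h)]
      exact mul_le_mul_of_nonneg_left (hfM _ _ h) (inv_nonneg.2 (sub_nonneg.2 h))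
    · rw [abs_of_nonpos (sub_nonpos.2 h), norm_sub_rev, ← neg_sub t s, neg_neg, inv_neg,
        neg_mul, ← mul_neg, neg_sub]
      exact mul_le_mul_of_nonneg_left (hfM _ _ h) (inv_nonneg.2 (sub_nonneg.2 h))
  have hMt := hasDerivAt_iff_tendsto_slope.1 hM
  have hm0 : 0 ≤ m := ge_of_tendsto' hMt fun s => (norm_nonneg _).trans (hslope s)
  have hc : Cauchy (map (slope f t) (𝓝[≠] t)) := by
    refine Metric.cauchy_iff.2 ⟨inferInstance, fun ε hε => ?_⟩
    -- Slopes near `t` lie in the thin cap `‖x‖ < m + δ`, `⟪u, x⟫ > m - δ`. By the parallelogram law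
    -- two of them satisfy `‖x - y‖² ≤ 4(m + δ)² - 4(m - δ)² = 16mδ` when `δ ≤ m`. If `m ≤ δ`, then
    -- `4(m + δ)² ≤ 8(m + δ)δ` suffices.
    obtain ⟨δ, hδ, hδε⟩ : ∃ δ > 0, 16 * (m + δ) * δ < ε ^ 2 := by
      have hcont : Tendsto (fun δ : ℝ => 16 * (m + δ) * δ) (𝓝[>] 0) (𝓝 0) := by
        have : Continuous fun δ : ℝ => 16 * (m + δ) * δ := by fun_prop
        simpa using (this.tendsto 0).mono_left nhdsWithin_le_nhds
      obtain ⟨δ, h1, h2⟩ := ((hcont.eventually (gt_mem_nhds (by positivity : 0 < ε ^ 2))).and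
        self_mem_nhdsWithin).exists
      exact ⟨δ, h2, h1⟩
    obtain ⟨u, hu, l, hl, hml⟩ := happ δ hδ
    have hl' := hasDerivAt_iff_tendsto_slope.1 hl
    have hev : ∀ᶠ s in 𝓝[≠] t, ‖slope f t s‖ < m + δ ∧ m - δ < inner ℝ u (slope f t s) := by
      filter_upwards [hMt.eventually (gt_mem_nhds (lt_add_of_pos_right m hδ)),
        hl'.eventually (lt_mem_nhds hml)] with s h1 h2
      refine ⟨(hslope s).trans_lt h1, ?_⟩
      simpa [slope_def_module, inner_smul_right, inner_sub_right] using h2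
    refine ⟨_, image_mem_map hev, ?_⟩
    rintro _ ⟨p, ⟨hp1, hp2⟩, rfl⟩ _ ⟨q, ⟨hq1, hq2⟩, rfl⟩
    set x := slope f t p
    set y := slope f t q
    rw [dist_eq_norm]
    refine lt_of_pow_lt_pow_left₀ 2 hε.le (lt_of_le_of_lt ?_ hδε)
    have hpar := parallelogram_law_with_norm ℝ x y
    have hin : 2 * (m - δ) ≤ ‖x + y‖ := by
      calc 2 * (m - δ) ≤ inner ℝ u (x + y) := by rw [inner_add_right]; linarith
        _ ≤ ‖u‖ * ‖x + y‖ := real_inner_le_norm _ _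
        _ ≤ ‖x + y‖ := mul_le_of_le_one_left (norm_nonneg _) hu
    have hx2 : ‖x‖ * ‖x‖ ≤ (m + δ) * (m + δ) :=
      mul_self_le_mul_self (norm_nonneg _) hp1.le
    have hy2 : ‖y‖ * ‖y‖ ≤ (m + δ) * (m + δ) :=
      mul_self_le_mul_self (norm_nonneg _) hq1.le
    rcases le_total 0 (m - δ) with h | h
    · have := mul_self_le_mul_self (by positivity) hin
      nlinarith
    · have := mul_self_nonneg ‖x + y‖
      nlinarith
  obtain ⟨l, hl⟩ := CompleteSpace.complete hc
  exact (hasDerivAt_iff_tendsto_slope.2 hl).differentiableAt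

/-- A Lipschitz curve in a separable Hilbert space is almost everywhere differentiable. -/
theorem LipschitzWith.ae_differentiableAt_of_separable {E : Type*} [NormedAddCommGroup E]
    [InnerProductSpace ℝ E] [CompleteSpace E] [TopologicalSpace.SeparableSpace E]
    {C : ℝ≥0} {f : ℝ → E} (hf : LipschitzWith C f) : ∀ᵐ t, DifferentiableAt ℝ f t := by
  have hd := TopologicalSpace.denseRange_denseSeq E
  set d := TopologicalSpace.denseSeq E
  let φ : ℕ → ℝ → ℝ := fun n s => inner ℝ (‖d n‖⁻¹ • d n) (f s)
  have hu : ∀ n, ‖‖d n‖⁻¹ • d n‖ ≤ 1 := fun n => by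
    rw [norm_smul, norm_inv, norm_norm]; exact inv_mul_le_one
  have hφ : ∀ n, LipschitzWith C (φ n) := by
    intro n
    refine ((innerSL ℝ (‖d n‖⁻¹ • d n)).lipschitz.comp hf).weaken ?_
    refine mul_le_of_le_one_left (zero_le) ?_
    rw [← NNReal.coe_le_coe, coe_nnnorm, innerSL_apply_norm]
    exact hu n
  have hφ' : ∀ n t, ‖deriv (φ n) t‖ ≤ C := fun n t => norm_deriv_le_of_lipschitz (hφ n)
  -- The candidate for the speed of `f`. A countable supremum keeps it measurable.
  let m : ℝ → ℝ := fun t => ⨆ n, ‖deriv (φ n) t‖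
  have hle : ∀ n t, ‖deriv (φ n) t‖ ≤ m t := fun n t =>
    le_ciSup (f := fun n => ‖deriv (φ n) t‖) ⟨C, by rintro _ ⟨n, rfl⟩; exact hφ' n t⟩ n
  have hm0 : ∀ t, 0 ≤ m t := fun t => (norm_nonneg _).trans (hle 0 t)
  have hmC : ∀ t, ‖m t‖ ≤ C := fun t => by
    rw [Real.norm_of_nonneg (hm0 t)]
    exact ciSup_le fun n => hφ' n t
  have hmm : Measurable m := Measurable.iSup fun n => (measurable_deriv _).norm
  have hmint : LocallyIntegrable m volume :=
    (locallyIntegrable_const (C : ℝ)).mono hmm.aestronglyMeasurable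
      (.of_forall fun t => by simpa using hmC t)
  have hI : ∀ a b, IntervalIntegrable m volume a b := fun a b =>
    (hmint.integrableOn_isCompact isCompact_uIcc).intervalIntegrable
  have hdm : ∀ n t, deriv (fun s => inner ℝ (d n) (f s)) t ≤ ‖d n‖ * m t := by
    intro n t
    rcases eq_or_ne (d n) 0 with h | h
    · simp [h]
    · have : (fun s => inner ℝ (d n) (f s)) = fun s => ‖d n‖ * φ n s := by
        ext s
        simp only [φ, real_inner_smul_left]
        rw [mul_inv_cancel_left₀ (norm_ne_zero_iff.2 h)]
      rw [this, deriv_const_mul_field]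
      exact mul_le_mul_of_nonneg_left ((le_abs_self _).trans (hle n t)) (norm_nonneg _)
  have hdiff : ∀ᵐ t, ∀ n, DifferentiableAt ℝ (φ n) t :=
    ae_all_iff.2 fun n => (hφ n).ae_differentiableAt_real
  filter_upwards [hdiff, LocallyIntegrable.ae_hasDerivAt_integral hmint] with t h1 h2
  refine differentiableAt_of_norm_sub_le (M := fun x => ∫ s in (0 : ℝ)..x, m s) ?_ (h2 0) ?_
  · intro a b hab
    rw [intervalIntegral.integral_interval_sub_left (hI _ _)
      (hI _ _)]
    exact norm_sub_le_integral_of_deriv_inner_le hf hd hmint hm0 hdm hab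
  · intro ε hε
    obtain ⟨n, hn⟩ := exists_lt_of_lt_ciSup (sub_lt_self (m t) hε)
    -- The sign of the derivative decides between the direction of `d n` and its opposite.
    rcases abs_cases (deriv (φ n) t) with ⟨h, _⟩ | ⟨h, _⟩
    · exact ⟨_, hu n, _, (h1 n).hasDerivAt, by rwa [← h]⟩
    · refine ⟨-(‖d n‖⁻¹ • d n), by rw [norm_neg]; exact hu n, -deriv (φ n) t, ?_, by rwa [← h]⟩
      simpa only [inner_neg_left] using! (h1 n).hasDerivAt.neg

/-- A Lipschitz curve in a Hilbert space is almost everywhere differentiable. -/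
theorem LipschitzWith.ae_differentiableAt_of_innerProductSpace {H : Type*} [NormedAddCommGroup H]
    [InnerProductSpace ℝ H] [CompleteSpace H] {C : ℝ≥0} {f : ℝ → H} (hf : LipschitzWith C f) :
    ∀ᵐ t, DifferentiableAt ℝ f t := by
  -- The curve lives in the closed span of its range, which is separable even if `H` is not.
  let S : Submodule ℝ H := (Submodule.span ℝ (range f)).topologicalClosure
  have hsep : TopologicalSpace.IsSeparable (S : Set H) := by
    rw [Submodule.topologicalClosure_coe]
    exact (TopologicalSpace.isSeparable_range hf.continuous).span.closure
  have : TopologicalSpace.SeparableSpace S := hsep.separableSpace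
  have : CompleteSpace S :=
    (Submodule.isClosed_topologicalClosure _).completeSpace_coe
  have hmem : ∀ t, f t ∈ S := fun t =>
    Submodule.le_topologicalClosure _ (Submodule.subset_span (mem_range_self t))
  have hg : LipschitzWith C (fun t => (⟨f t, hmem t⟩ : S)) := fun x y => hf x y
  filter_upwards [hg.ae_differentiableAt_of_separable] with t ht
  exact S.subtypeL.differentiableAt.comp t ht

/-! ### Global solutions of Lipschitz equations by a weighted norm. -/

/-- For `W' = 2 κ`, the function `κ e ^ W` has primitive `e ^ W / 2`. -/
theorem integral_mul_exp_eq {κ W : ℝ → ℝ} (hκ : Continuous κ)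
    (hW : ∀ t, HasDerivAt W (2 * κ t) t) (a b : ℝ) :
    ∫ s in a..b, κ s * Real.exp (W s) = (Real.exp (W b) - Real.exp (W a)) / 2 := by
  have hWc : Continuous W := continuous_iff_continuousAt.2 fun t => (hW t).continuousAt
  rw [intervalIntegral.integral_eq_sub_of_hasDerivAt (f := fun t => Real.exp (W t) / 2)]
  · ring
  · intro t _
    convert! ((hW t).exp.div_const 2) using 1
    ring
  · exact (by fun_prop : Continuous fun s => κ s * Real.exp (W s)).intervalIntegrable _ _

/-- **Global Picard–Lindelöf theorem.** A continuous vector field that is Lipschitz in space, with a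
Lipschitz constant depending continuously on time, has a solution on `[t₀, ∞)` starting from any
point. -/
theorem exists_forall_hasDerivWithinAt_Ici_of_lipschitz {E : Type*} [NormedAddCommGroup E]
    [NormedSpace ℝ E] [CompleteSpace E] {f : ℝ → E → E} (hf : Continuous fun p : ℝ × E => f p.1 p.2)
    {k : ℝ → ℝ} (hk : Continuous k) (hfk : ∀ t x y, ‖f t x - f t y‖ ≤ k t * ‖x - y‖)
    (t₀ : ℝ) (x₀ : E) :
    ∃ u : ℝ → E, u t₀ = x₀ ∧ ∀ t ∈ Ici t₀, HasDerivWithinAt u (f t (u t)) (Ici t₀) t := by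
  -- A single function that dominates both the Lipschitz constant and the field at the origin.
  let κ : ℝ → ℝ := fun t => |k t| + ‖f t 0‖
  have hf0 : Continuous fun t => f t 0 := hf.comp (by fun_prop : Continuous fun t => (t, (0 : E)))
  have hκ : Continuous κ := by fun_prop
  have hκ0 : ∀ t, 0 ≤ κ t := fun t => by positivity
  have hfκ : ∀ t x y, ‖f t x - f t y‖ ≤ κ t * ‖x - y‖ := fun t x y =>
    (hfk t x y).trans <| mul_le_mul_of_nonneg_right
      ((le_abs_self _).trans (le_add_of_nonneg_right (norm_nonneg _))) (norm_nonneg _)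
  -- Bielecki weight: the unknown is `v = e ^ (-W) u`. The factor 2 makes the Picard map a
  -- contraction with constant `1 / 2` on the whole half-line at once.
  let W : ℝ → ℝ := fun t => ∫ s in t₀..t, 2 * κ s
  have hW : ∀ t, HasDerivAt W (2 * κ t) t := fun t =>
    intervalIntegral.integral_hasDerivAt_right
      ((continuous_const.mul hκ).intervalIntegrable _ _)
      ((continuous_const.mul hκ).stronglyMeasurableAtFilter _ _)
      (continuous_const.mul hκ).continuousAt
  have hWc : Continuous W := continuous_iff_continuousAt.2 fun t => (hW t).continuousAt
  have hW₀ : W t₀ = 0 := intervalIntegral.integral_same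
  have hWnonneg : ∀ t, t₀ ≤ t → 0 ≤ W t := fun t ht =>
    intervalIntegral.integral_nonneg ht fun s _ => by have := hκ0 s; positivity
  have hκW : Continuous fun s => κ s * Real.exp (W s) := by fun_prop
  have hint : ∀ t, ∫ s in t₀..t, κ s * Real.exp (W s) ≤ Real.exp (W t) / 2 := fun t => by
    rw [integral_mul_exp_eq hκ hW, hW₀]
    linarith [Real.exp_pos 0]
  let F : (ℝ → E) → ℝ → E := fun v s => f s (Real.exp (W s) • v s)
  have hF : ∀ v : ℝ → E, Continuous v → Continuous (F v) := fun v hv =>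
    hf.comp (by fun_prop : Continuous fun s => (s, Real.exp (W s) • v s))
  -- The Picard map in the weighted unknown. With `max t t₀` it is constant to the left of `t₀`, so
  -- it acts on bounded continuous functions on all of `ℝ`.
  let Φ : (ℝ → E) → ℝ → E := fun v t =>
    Real.exp (-W (max t t₀)) • (x₀ + ∫ s in t₀..max t t₀, F v s)
  have hΦc : ∀ v : ℝ → E, Continuous v → Continuous (Φ v) := by
    intro v hv
    have h1 : Continuous fun t => ∫ s in t₀..t, F v s :=
      intervalIntegral.continuous_primitive (fun a b => (hF v hv).intervalIntegrable a b) t₀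
    have h2 : Continuous fun t => ∫ s in t₀..max t t₀, F v s := h1.comp (by fun_prop)
    fun_prop
  have hΦb : ∀ v : BoundedContinuousFunction ℝ E, ∀ t, ‖Φ v t‖ ≤ ‖x₀‖ + (1 + ‖v‖) / 2 := by
    intro v t
    have hτ : t₀ ≤ max t t₀ := le_max_right _ _
    have h1 : ‖∫ s in t₀..max t t₀, F v s‖ ≤
        ∫ s in t₀..max t t₀, (1 + ‖v‖) * (κ s * Real.exp (W s)) := by
      refine intervalIntegral.norm_integral_le_of_norm_le hτ (.of_forall fun s hs => ?_)
        ((continuous_const.mul hκW).intervalIntegrable _ _)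
      have hexp : 1 ≤ Real.exp (W s) := Real.one_le_exp (hWnonneg s hs.1.le)
      have h3 := hfκ s (Real.exp (W s) • v s) 0
      rw [sub_zero, norm_smul, Real.norm_of_nonneg (Real.exp_pos _).le] at h3
      have h4 : ‖f s 0‖ ≤ κ s := le_add_of_nonneg_left (abs_nonneg _)
      calc ‖F v s‖ ≤ ‖F v s - f s 0‖ + ‖f s 0‖ := norm_le_norm_sub_add _ _
        _ ≤ κ s * (Real.exp (W s) * ‖v‖) + κ s * Real.exp (W s) := by
            gcongr
            · refine h3.trans ?_
              have := hκ0 s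
              gcongr
              exact v.norm_coe_le_norm s
            · exact h4.trans (le_mul_of_one_le_right (hκ0 s) hexp)
        _ = _ := by ring
    rw [intervalIntegral.integral_const_mul] at h1
    have h2 : ‖x₀ + ∫ s in t₀..max t t₀, F v s‖ ≤
        Real.exp (W (max t t₀)) * (‖x₀‖ + (1 + ‖v‖) / 2) := by
      have h3 := mul_le_mul_of_nonneg_left (hint (max t t₀))
        (by positivity : 0 ≤ 1 + ‖v‖)
      have h4 := le_mul_of_one_le_left (norm_nonneg x₀)
        (Real.one_le_exp (hWnonneg _ hτ))
      linarith [norm_add_le x₀ (∫ s in t₀..max t t₀, F v s)]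
    rw [norm_smul, Real.norm_of_nonneg (Real.exp_pos _).le, Real.exp_neg]
    exact inv_mul_le_of_le_mul₀ (Real.exp_pos _).le (by positivity) h2
  let T : BoundedContinuousFunction ℝ E → BoundedContinuousFunction ℝ E := fun v =>
    BoundedContinuousFunction.ofNormedAddCommGroup (Φ v) (hΦc v v.continuous) _ (hΦb v)
  have hT : ContractingWith (1 / 2) T := by
    refine ⟨by norm_num, LipschitzWith.of_dist_le_mul fun v w => ?_⟩
    refine (BoundedContinuousFunction.dist_le (by positivity)).2 fun t => ?_
    have hτ : t₀ ≤ max t t₀ := le_max_right _ _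
    have h1 : ‖∫ s in t₀..max t t₀, (F v s - F w s)‖ ≤
        ∫ s in t₀..max t t₀, dist v w * (κ s * Real.exp (W s)) := by
      refine intervalIntegral.norm_integral_le_of_norm_le hτ (.of_forall fun s _ => ?_)
        ((continuous_const.mul hκW).intervalIntegrable _ _)
      refine (hfκ s _ _).trans ?_
      rw [← smul_sub, norm_smul, Real.norm_of_nonneg (Real.exp_pos _).le]
      calc κ s * (Real.exp (W s) * ‖v s - w s‖) ≤ κ s * (Real.exp (W s) * dist v w) := by
            have := hκ0 s
            gcongr
            rw [← dist_eq_norm]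
            exact v.dist_coe_le_dist s
        _ = _ := by ring
    rw [intervalIntegral.integral_const_mul] at h1
    change dist (Φ v t) (Φ w t) ≤ _
    have h2 : Φ v t - Φ w t =
        Real.exp (-W (max t t₀)) • ∫ s in t₀..max t t₀, (F v s - F w s) := by
      rw [intervalIntegral.integral_sub ((hF v v.continuous).intervalIntegrable _ _)
        ((hF w w.continuous).intervalIntegrable _ _), ← smul_sub, add_sub_add_left_eq_sub]
    rw [dist_eq_norm, h2, norm_smul, Real.norm_of_nonneg (Real.exp_pos _).le, Real.exp_neg]
    refine inv_mul_le_of_le_mul₀ (Real.exp_pos _).le (by positivity) (h1.trans ?_)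
    refine (mul_le_mul_of_nonneg_left (hint _) dist_nonneg).trans (le_of_eq ?_)
    push_cast
    ring
  let v := ContractingWith.fixedPoint T hT
  have hv : ∀ t, v t = Φ v t := fun t =>
    (DFunLike.congr_fun hT.fixedPoint_isFixedPt t).symm
  let u : ℝ → E := fun t => Real.exp (W t) • v t
  have huc : Continuous u := by fun_prop
  have hfu : Continuous fun s => f s (u s) := hF v v.continuous
  have hu : ∀ t ∈ Ici t₀, u t = x₀ + ∫ s in t₀..t, f s (u s) := by
    intro t ht
    change Real.exp (W t) • v t = _
    rw [hv t]
    simp only [Φ, max_eq_left (mem_Ici.1 ht), smul_smul, ← Real.exp_add, add_neg_cancel,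
      Real.exp_zero, one_smul]
    rfl
  refine ⟨u, by simpa using hu t₀ self_mem_Ici, fun t ht => ?_⟩
  have hder : HasDerivAt (fun t => x₀ + ∫ s in t₀..t, f s (u s)) (f t (u t)) t :=
    (intervalIntegral.integral_hasDerivAt_right (hfu.intervalIntegrable _ _)
      (hfu.stronglyMeasurableAtFilter _ _) hfu.continuousAt).const_add x₀
  exact hder.hasDerivWithinAt.congr hu (hu t ht)

/-! ### Absolutely continuous and locally Lipschitz curves on a half-line. -/

open AbsolutelyContinuousOnInterval in
/-- Absolute continuity on an interval depends only on the values on that interval. -/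
theorem AbsolutelyContinuousOnInterval.congr_of_eqOn {X : Type*} [PseudoMetricSpace X]
    {f g : ℝ → X} {a b : ℝ} (hf : AbsolutelyContinuousOnInterval f a b)
    (h : EqOn g f (uIcc a b)) : AbsolutelyContinuousOnInterval g a b := by
  rw [absolutelyContinuousOnInterval_iff] at hf ⊢
  intro ε hε
  obtain ⟨δ, hδ, H⟩ := hf ε hε
  refine ⟨δ, hδ, fun E hE hEδ => ?_⟩
  convert! H E hE hEδ using 1
  refine Finset.sum_congr rfl fun i hi => ?_
  rw [h (hE.1 i hi).1, h (hE.1 i hi).2]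

open AbsolutelyContinuousOnInterval in
/-- The composition of a Lipschitz map with an absolutely continuous curve is absolutely
continuous. -/
theorem LipschitzWith.comp_absolutelyContinuousOnInterval {X Y : Type*} [PseudoMetricSpace X]
    [PseudoMetricSpace Y] {V : X → Y} {L : ℝ≥0} (hV : LipschitzWith L V) {f : ℝ → X} {a b : ℝ}
    (hf : AbsolutelyContinuousOnInterval f a b) :
    AbsolutelyContinuousOnInterval (fun t => V (f t)) a b := by
  refine squeeze_zero (fun E => Finset.sum_nonneg fun i _ => dist_nonneg) (fun E => ?_)
    (by simpa using Filter.Tendsto.const_mul (L : ℝ) hf)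
  rw [Finset.mul_sum]
  exact Finset.sum_le_sum fun i _ => hV.dist_le_mul _ _

/-- A curve in a Hilbert space that is Lipschitz on the compact subintervals of `[t₀, ∞)` is
differentiable at almost every point of `[t₀, ∞)`. -/
theorem ae_restrict_Ici_differentiableAt {H : Type*} [NormedAddCommGroup H]
    [InnerProductSpace ℝ H] [CompleteSpace H] {g : ℝ → H} {t₀ : ℝ}
    (hg : ∀ T, ∃ K : ℝ≥0, LipschitzOnWith K g (Icc t₀ T)) :
    ∀ᵐ t ∂(volume.restrict (Ici t₀)), DifferentiableAt ℝ g t := by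
  have h : ∀ n : ℕ, ∀ᵐ t : ℝ, t ∈ Ioo t₀ (t₀ + n) → DifferentiableAt ℝ g t := by
    intro n
    have hn : t₀ ≤ t₀ + n := le_add_of_nonneg_right n.cast_nonneg
    obtain ⟨K, hK⟩ := hg (t₀ + n)
    -- The constant extension is globally Lipschitz and agrees with `g` near each interior point.
    have hL : LipschitzWith (K * 1) (IccExtend hn ((Icc t₀ (t₀ + n)).domRestrict g)) :=
      hK.to_restrict.comp (LipschitzWith.projIcc hn)
    filter_upwards [hL.ae_differentiableAt_of_innerProductSpace] with t ht htn
    refine ht.congr_of_eventuallyEq ?_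
    filter_upwards [isOpen_Ioo.mem_nhds htn] with s hs
    exact (IccExtend_of_mem hn ((Icc t₀ (t₀ + n)).domRestrict g) (Ioo_subset_Icc_self hs)).symm
  rw [ae_restrict_iff' measurableSet_Ici]
  filter_upwards [ae_all_iff.2 h, Measure.ae_ne volume t₀] with t ht hne hmem
  obtain ⟨n, hn⟩ := exists_nat_gt (t - t₀)
  exact ht n ⟨lt_of_le_of_ne hmem hne.symm, by linarith⟩

/-- An absolutely continuous curve on the compact subintervals of `[t₀, ∞)` whose almost everywhere
derivative is a continuous function has that derivative everywhere. -/
theorem hasDerivWithinAt_of_ae_hasDerivWithinAt {E : Type*} [NormedAddCommGroup E]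
    [NormedSpace ℝ E] [CompleteSpace E] {w F : ℝ → E} {t₀ : ℝ}
    (hw : LocallyAbsolutelyContinuousFrom w t₀) (hF : ContinuousOn F (Ici t₀))
    (h : ∀ᵐ t ∂(volume.restrict (Ici t₀)), HasDerivWithinAt w (F t) (Ici t₀) t) :
    ∀ t ∈ Ici t₀, HasDerivWithinAt w (F t) (Ici t₀) t := by
  let G : ℝ → E := fun t => F (max t t₀)
  have hG : Continuous G :=
    hF.comp_continuous (by fun_prop) fun t => le_max_right t t₀
  have hGF : ∀ t ∈ Ici t₀, G t = F t := fun t ht => by simp only [G, max_eq_left (mem_Ici.1 ht)]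
  let P : ℝ → E := fun t => ∫ s in t₀..t, G s
  have hP : ∀ t, HasDerivAt P (G t) t := fun t =>
    intervalIntegral.integral_hasDerivAt_right (hG.intervalIntegrable _ _)
      (hG.stronglyMeasurableAtFilter _ _) hG.continuousAt
  have hP1 : ContDiff ℝ 1 P := contDiff_one_iff_deriv.2
    ⟨fun t => (hP t).differentiableAt, by rwa [funext fun t => (hP t).deriv]⟩
  have hwP : ∀ t ∈ Ici t₀, w t = w t₀ + P t := by
    intro t ht
    -- The difference is absolutely continuous with zero derivative almost everywhere, hence
    -- constant.
    have hAC : AbsolutelyContinuousOnInterval (w - P) t₀ t :=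
      (hw t ht).sub hP1.contDiffOn.absolutelyContinuousOnInterval
    have hz : ∀ᵐ x, x ∈ uIcc t₀ t → HasDerivAt (w - P) 0 x := by
      rw [ae_restrict_iff' measurableSet_Ici] at h
      filter_upwards [h, Measure.ae_ne volume t₀] with x hx hne hmem
      rw [uIcc_of_le ht] at hmem
      have hlt : t₀ < x := lt_of_le_of_ne hmem.1 hne.symm
      have := ((hx hmem.1).hasDerivAt (Ici_mem_nhds hlt)).sub (hP x)
      rwa [hGF x hmem.1, sub_self] at this
    obtain ⟨C, hC⟩ := hAC.const_of_ae_hasDerivAt_zero hz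
    have h1 := (hC t right_mem_uIcc).trans (hC t₀ left_mem_uIcc).symm
    have h2 : P t₀ = 0 := intervalIntegral.integral_same
    simp only [Pi.sub_apply, h2, sub_zero] at h1
    rw [← h1, sub_add_cancel]
  intro t ht
  rw [← hGF t ht]
  exact ((hP t).const_add (w t₀)).hasDerivWithinAt.congr hwP (hwP t ht)

/-! ### The first order system. -/

/-- The vector field of the first order system in `(y, w)`, `w = y' + a V(y)`, that is equivalent to
`y'' + lam y' + a (V(y))' + (a' - b) V(y) = 0`. -/
def dampedField {H : Type*} [NormedAddCommGroup H] [NormedSpace ℝ H] (lam : ℝ) (a b : ℝ → ℝ)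
    (V : H → H) (t : ℝ) (x : H × H) : H × H :=
  (x.2 - a t • V x.1, b t • V x.1 - lam • (x.2 - a t • V x.1))

section DampedField

variable {H : Type*} [NormedAddCommGroup H] [NormedSpace ℝ H] {lam : ℝ} {a b : ℝ → ℝ} {V : H → H}
  {L : ℝ≥0}

theorem continuous_dampedField (ha : Continuous a) (hb : Continuous b) (hV : Continuous V) :
    Continuous fun p : ℝ × (H × H) => dampedField lam a b V p.1 p.2 := by
  unfold dampedField
  fun_prop

/-- The first component `p` has Lipschitz constant `1 + |a| L`, and the second is `b V - lam p`. The
sum of the bounds dominates both components, and for continuous `a`, `b` it is continuous in `t`. -/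
theorem norm_dampedField_sub_le (hV : LipschitzWith L V) (t : ℝ) (x y : H × H) :
    ‖dampedField lam a b V t x - dampedField lam a b V t y‖ ≤
      ((1 + |lam|) * (1 + |a t| * L) + |b t| * L) * ‖x - y‖ := by
  have h1 : ‖x.1 - y.1‖ ≤ ‖x - y‖ := norm_fst_le (x - y)
  have h2 : ‖x.2 - y.2‖ ≤ ‖x - y‖ := norm_snd_le (x - y)
  have hVxy : ‖V x.1 - V y.1‖ ≤ L * ‖x - y‖ :=
    (hV.norm_sub_le _ _).trans (mul_le_mul_of_nonneg_left h1 L.2)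
  have hp : ‖(x.2 - a t • V x.1) - (y.2 - a t • V y.1)‖ ≤ (1 + |a t| * L) * ‖x - y‖ := by
    calc _ = ‖(x.2 - y.2) - a t • (V x.1 - V y.1)‖ := by congr 1; module
      _ ≤ ‖x.2 - y.2‖ + |a t| * ‖V x.1 - V y.1‖ := by
        rw [← Real.norm_eq_abs, ← norm_smul]; exact norm_sub_le _ _
      _ ≤ ‖x - y‖ + |a t| * (L * ‖x - y‖) := by gcongr
      _ = _ := by ring
  have hq : ‖(b t • V x.1 - lam • (x.2 - a t • V x.1)) -
      (b t • V y.1 - lam • (y.2 - a t • V y.1))‖ ≤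
      |b t| * (L * ‖x - y‖) + |lam| * ((1 + |a t| * L) * ‖x - y‖) := by
    calc _ = ‖b t • (V x.1 - V y.1) - lam • ((x.2 - a t • V x.1) - (y.2 - a t • V y.1))‖ := by
          congr 1; module
      _ ≤ |b t| * ‖V x.1 - V y.1‖ + |lam| * ‖(x.2 - a t • V x.1) - (y.2 - a t • V y.1)‖ := by
        rw [← Real.norm_eq_abs, ← Real.norm_eq_abs, ← norm_smul, ← norm_smul]
        exact norm_sub_le _ _
      _ ≤ _ := by gcongr
  have hn : 0 ≤ |b t| * (L * ‖x - y‖) := by positivity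
  have hn' : 0 ≤ |lam| * ((1 + |a t| * L) * ‖x - y‖) := by positivity
  have hn'' : 0 ≤ (1 + |a t| * L) * ‖x - y‖ := by positivity
  refine max_le (hp.trans ?_) (hq.trans ?_) <;> linarith

/-- Two trajectories of the damped field on `[t₀, ∞)` with the same initial point coincide. -/
theorem eqOn_of_hasDerivWithinAt_dampedField (ha : Continuous a) (hb : Continuous b)
    (hV : LipschitzWith L V) {t₀ : ℝ} {u v : ℝ → H × H}
    (hu : ∀ t ∈ Ici t₀, HasDerivWithinAt u (dampedField lam a b V t (u t)) (Ici t₀) t)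
    (hv : ∀ t ∈ Ici t₀, HasDerivWithinAt v (dampedField lam a b V t (v t)) (Ici t₀) t)
    (h0 : u t₀ = v t₀) : EqOn u v (Ici t₀) := by
  intro T hT
  have hk : Continuous fun t => (1 + |lam|) * (1 + |a t| * L) + |b t| * L := by fun_prop
  -- On a compact interval one Lipschitz constant serves all times, as Grönwall uniqueness requires.
  obtain ⟨K, hK⟩ := (isCompact_Icc (a := t₀) (b := T)).exists_bound_of_continuousOn hk.continuousOn
  have hLip : ∀ t ∈ Ico t₀ T, LipschitzOnWith K.toNNReal (dampedField lam a b V t) univ := by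
    intro t ht
    refine LipschitzOnWith.of_dist_le_mul fun x _ y _ => ?_
    rw [dist_eq_norm, dist_eq_norm]
    refine (norm_dampedField_sub_le hV t x y).trans ?_
    gcongr
    exact (le_abs_self _).trans ((hK t (Ico_subset_Icc_self ht)).trans K.le_coe_toNNReal)
  refine ODE_solution_unique_of_mem_Icc_right hLip
    (fun t ht => ((hu t ht.1).continuousWithinAt).mono Icc_subset_Ici_self)
    (fun t ht => (hu t ht.1).mono (Ici_subset_Ici.2 ht.1)) (fun _ _ => mem_univ _)
    (fun t ht => ((hv t ht.1).continuousWithinAt).mono Icc_subset_Ici_self)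
    (fun t ht => (hv t ht.1).mono (Ici_subset_Ici.2 ht.1)) (fun _ _ => mem_univ _)
    h0 ⟨hT, le_rfl⟩

end DampedField

/-! ### Strong solutions correspond to trajectories. -/

section StrongSolution

variable {H : Type*} [NormedAddCommGroup H] [InnerProductSpace ℝ H] [CompleteSpace H]
  {t₀ lam : ℝ} {μ γ : ℝ → ℝ} {V : H → H} {L : ℝ≥0} {y₀ y₁ : H}

/-- The pair `(y, y' + μ V(y))` formed from a strong global solution is a trajectory of the
associated first order system. -/
theorem IsStrongGlobalSolution.hasDerivWithinAt_prodMk {y : ℝ → H}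
    (hμ : ContDiffOn ℝ 1 μ (Ici t₀)) (hγ : ContinuousOn γ (Ici t₀)) (hV : LipschitzWith L V)
    (hy : IsStrongGlobalSolution t₀ lam μ γ V y₀ y₁ y) :
    ∀ t ∈ Ici t₀, HasDerivWithinAt (fun s => (y s, derivWithin y (Ici t₀) s + μ s • V (y s)))
      (dampedField lam μ (fun s => derivWithin μ (Ici t₀) s - γ s) V t
        (y t, derivWithin y (Ici t₀) t + μ t • V (y t))) (Ici t₀) t := by
  set y' := derivWithin y (Ici t₀)
  set μ' := derivWithin μ (Ici t₀)
  have hud : UniqueDiffOn ℝ (Ici t₀) := uniqueDiffOn_Ici t₀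
  have hμ' := (contDiffOn_one_iff_derivWithin hud).1 hμ
  have hyc : ContinuousOn y (Ici t₀) := hy.differentiableOn.continuousOn
  have hy'c : ContinuousOn y' (Ici t₀) := by
    intro t ht
    have h := (hy.locAbsCont_deriv (t + 1) (le_add_of_le_of_nonneg ht zero_le_one)).continuousOn
    rw [uIcc_of_le (le_add_of_le_of_nonneg ht zero_le_one)] at h
    refine (h t ⟨ht, by linarith⟩).mono_of_mem_nhdsWithin ?_
    rw [← Ici_inter_Iic]
    exact inter_mem_nhdsWithin _ (Iic_mem_nhds (by linarith))
  have hw : LocallyAbsolutelyContinuousFrom (fun s => y' s + μ s • V (y s)) t₀ := by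
    intro T hT
    have hμT : AbsolutelyContinuousOnInterval μ t₀ T := by
      refine ContDiffOn.absolutelyContinuousOnInterval (hμ.mono ?_)
      rw [uIcc_of_le hT]
      exact Icc_subset_Ici_self
    exact (hy.locAbsCont_deriv T hT).fun_add
      (hμT.fun_smul (hV.comp_absolutelyContinuousOnInterval (hy.locAbsCont T hT)))
  have hVc : ContinuousOn (fun s => V (y s)) (Ici t₀) := hV.continuous.comp_continuousOn hyc
  -- Almost everywhere the product rule and the equation cancel `μ (V(y))'`. What remains is
  -- continuous, so it is the derivative everywhere.
  have hder := hasDerivWithinAt_of_ae_hasDerivWithinAt hw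
    (F := fun t => (μ' t - γ t) • V (y t) - lam • y' t)
    (((hμ'.2.sub hγ).smul hVc).sub (hy'c.const_smul lam)) (by
      filter_upwards [hy.equation, ae_restrict_mem measurableSet_Ici] with t ⟨h1, h2, h3⟩ ht
      have h4 := h1.hasDerivWithinAt.add
        ((hμ'.1 t ht).hasDerivWithinAt.smul h2.hasDerivWithinAt)
      refine h4.congr_deriv ?_
      rw [← sub_eq_zero, ← h3]
      module)
  intro t ht
  convert! (hy.differentiableOn t ht).hasDerivWithinAt.prodMk (hder t ht) using 1
  simp [dampedField, y', μ']

/-- The first component of a trajectory of the associated first order system is a strong global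
solution. -/
theorem isStrongGlobalSolution_fst {u : ℝ → H × H}
    (hμ : ContDiffOn ℝ 1 μ (Ici t₀)) (hγ : ContinuousOn γ (Ici t₀)) (hV : LipschitzWith L V)
    (hu : ∀ t ∈ Ici t₀, HasDerivWithinAt u
      (dampedField lam μ (fun s => derivWithin μ (Ici t₀) s - γ s) V t (u t)) (Ici t₀) t)
    (hu₀ : u t₀ = (y₀, y₁ + μ t₀ • V y₀)) :
    IsStrongGlobalSolution t₀ lam μ γ V y₀ y₁ (fun t => (u t).1) := by
  have hud : UniqueDiffOn ℝ (Ici t₀) := uniqueDiffOn_Ici t₀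
  have hμ' := (contDiffOn_one_iff_derivWithin hud).1 hμ
  have huc : ContinuousOn u (Ici t₀) := fun t ht => (hu t ht).continuousWithinAt
  have h1 : ∀ t ∈ Ici t₀, HasDerivWithinAt (fun s => (u s).1)
      ((u t).2 - μ t • V (u t).1) (Ici t₀) t := fun t ht => (hu t ht).fst
  have h2 : ∀ t ∈ Ici t₀, HasDerivWithinAt (fun s => (u s).2)
      ((derivWithin μ (Ici t₀) t - γ t) • V (u t).1 - lam • ((u t).2 - μ t • V (u t).1))
      (Ici t₀) t := fun t ht => (hu t ht).snd
  have hd1 : EqOn (derivWithin (fun s => (u s).1) (Ici t₀))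
      (fun t => (u t).2 - μ t • V (u t).1) (Ici t₀) := fun t ht => (h1 t ht).derivWithin (hud t ht)
  have hd2 : EqOn (derivWithin (fun s => (u s).2) (Ici t₀))
      (fun t => (derivWithin μ (Ici t₀) t - γ t) • V (u t).1 - lam • ((u t).2 - μ t • V (u t).1))
      (Ici t₀) := fun t ht => (h2 t ht).derivWithin (hud t ht)
  have hVc : ContinuousOn (fun t => V (u t).1) (Ici t₀) :=
    hV.continuous.comp_continuousOn huc.fst
  have hc1 : ContinuousOn (fun t => (u t).2 - μ t • V (u t).1) (Ici t₀) :=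
    huc.snd.sub (hμ.continuousOn.smul hVc)
  have hC1 : ContDiffOn ℝ 1 (fun s => (u s).1) (Ici t₀) :=
    (contDiffOn_one_iff_derivWithin hud).2
      ⟨fun t ht => (h1 t ht).differentiableWithinAt, hc1.congr hd1⟩
  have hC2 : ContDiffOn ℝ 1 (fun s => (u s).2) (Ici t₀) :=
    (contDiffOn_one_iff_derivWithin hud).2
      ⟨fun t ht => (h2 t ht).differentiableWithinAt,
        (((hμ'.2.sub hγ).smul hVc).sub (hc1.const_smul lam)).congr hd2⟩
  have hsub : ∀ T, t₀ ≤ T → uIcc t₀ T ⊆ Ici t₀ := fun T hT => by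
    rw [uIcc_of_le hT]
    exact Icc_subset_Ici_self
  have hAC1 : LocallyAbsolutelyContinuousFrom (fun s => (u s).1) t₀ := fun T hT =>
    (hC1.mono (hsub T hT)).absolutelyContinuousOnInterval
  refine ⟨hAC1, fun t ht => (h1 t ht).differentiableWithinAt, fun T hT => ?_, ?_, ?_, ?_⟩
  · refine AbsolutelyContinuousOnInterval.congr_of_eqOn ?_ (hd1.mono (hsub T hT))
    exact (hC2.mono (hsub T hT)).absolutelyContinuousOnInterval.fun_sub
      ((hμ.mono (hsub T hT)).absolutelyContinuousOnInterval.fun_smul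
        (hV.comp_absolutelyContinuousOnInterval (hAC1 T hT)))
  -- A `C¹` curve is Lipschitz on compact intervals, hence so is its image under `V`. Wherever
  -- `V(y)` is differentiable, so is `y' = w - μ V(y)`.
  · have hLip : ∀ T, ∃ K : ℝ≥0, LipschitzOnWith K (fun t => V (u t).1) (Icc t₀ T) := by
      intro T
      obtain ⟨K, hK⟩ := (hC1.mono (Icc_subset_Ici_self : Icc t₀ T ⊆ Ici t₀)).exists_lipschitzOnWith
        one_ne_zero (convex_Icc _ _) isCompact_Icc
      exact ⟨L * K, hV.comp_lipschitzOnWith hK⟩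
    filter_upwards [ae_restrict_Ici_differentiableAt hLip, ae_restrict_mem measurableSet_Ici]
      with t hVt ht
    have hVt' := hVt.differentiableWithinAt (s := Ici t₀)
    have h3 := ((h2 t ht).sub ((hμ'.1 t ht).hasDerivWithinAt.smul hVt'.hasDerivWithinAt)).congr
      hd1 (hd1 ht)
    refine ⟨h3.differentiableWithinAt, hVt', ?_⟩
    rw [h3.derivWithin (hud t ht), hd1 ht]
    module
  · simp [hu₀]
  · rw [hd1 self_mem_Ici]
    simp [hu₀]

end StrongSolution

theorem theorem4p1 {H : Type*} [NormedAddCommGroup H] [InnerProductSpace ℝ H] [CompleteSpace H]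
    (t₀ : ℝ) (ht₀ : 0 ≤ t₀) (lam : ℝ) (hlam : 0 < lam)
    (μ : ℝ → ℝ) (hμ_pos : ∀ t ∈ Set.Ici t₀, 0 < μ t) (hμ_C1 : ContDiffOn ℝ 1 μ (Set.Ici t₀))
    (hμ_mono : MonotoneOn μ (Set.Ici t₀))
    (γ : ℝ → ℝ) (hγ_pos : ∀ t ∈ Set.Ici t₀, 0 < γ t) (hγ_cont : ContinuousOn γ (Set.Ici t₀))
    (V : H → H) (L : ℝ≥0) (hV : LipschitzWith L V)
    (y₀ y₁ : H) :
    ∃ y : ℝ → H, IsStrongGlobalSolution t₀ lam μ γ V y₀ y₁ y ∧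
      ∀ z : ℝ → H, IsStrongGlobalSolution t₀ lam μ γ V y₀ y₁ z → Set.EqOn z y (Set.Ici t₀) := by
  let b : ℝ → ℝ := fun s => derivWithin μ (Ici t₀) s - γ s
  have hb : ContinuousOn b (Ici t₀) :=
    ((contDiffOn_one_iff_derivWithin (uniqueDiffOn_Ici t₀)).1 hμ_C1).2.sub hγ_cont
  -- The coefficients are frozen to the left of `t₀`, because the existence theorem needs a field
  -- continuous on all of `ℝ`.
  have hmax : Continuous fun t => max t t₀ := by fun_prop
  have hμe : Continuous fun t => μ (max t t₀) :=
    hμ_C1.continuousOn.comp_continuous hmax fun t => le_max_right t t₀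
  have hbe : Continuous fun t => b (max t t₀) :=
    hb.comp_continuous hmax fun t => le_max_right t t₀
  have hext : ∀ t ∈ Ici t₀, ∀ x : H × H,
      dampedField lam (fun t => μ (max t t₀)) (fun t => b (max t t₀)) V t x =
        dampedField lam μ b V t x := fun t ht x => by
    simp only [dampedField, max_eq_left (mem_Ici.1 ht)]
  have hk : Continuous fun t =>
      (1 + |lam|) * (1 + |μ (max t t₀)| * L) + |b (max t t₀)| * L :=
    (continuous_const.mul (continuous_const.add (hμe.abs.mul continuous_const))).add
      (hbe.abs.mul continuous_const)
  obtain ⟨u, hu₀, hu⟩ := exists_forall_hasDerivWithinAt_Ici_of_lipschitz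
    (f := dampedField lam (fun t => μ (max t t₀)) (fun t => b (max t t₀)) V)
    (continuous_dampedField hμe hbe hV.continuous) hk
    (fun t x y => norm_dampedField_sub_le hV t x y) t₀ (y₀, y₁ + μ t₀ • V y₀)
  have hu' : ∀ t ∈ Ici t₀, HasDerivWithinAt u (dampedField lam μ b V t (u t)) (Ici t₀) t :=
    fun t ht => (hu t ht).congr_deriv (hext t ht (u t))
  refine ⟨fun t => (u t).1, isStrongGlobalSolution_fst hμ_C1 hγ_cont hV hu' hu₀, fun z hz => ?_⟩
  have hz' := hz.hasDerivWithinAt_prodMk hμ_C1 hγ_cont hV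
  have hzu := eqOn_of_hasDerivWithinAt_dampedField hμe hbe hV
    (fun t ht => (hz' t ht).congr_deriv (hext t ht _).symm) hu
    (by rw [hu₀, hz.initial_pos, hz.initial_vel])
  exact fun t ht => congrArg Prod.fst (hzu ht)
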